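/- Let $M>0$ and $L>2M$. For $x\in\mathbb R$ and $\rho>0$ put $$\mathcal E_0(x,\rho)=\frac{\sqrt{(x-M)^2+\rho^2}+\sqrt{(x+M)^2+\rho^2}-2M}{\sqrt{(x-M)^2+\rho^2}+\sqrt{(x+M)^2+\rho^2}+2M},$$ $$\mathcal E(x,\rho)=\mathcal E_0(x,\rho)\prod_{n=1}^{\infty}\mathcal E_0(x+nL,\rho)\,\mathcal E_0(x-nL,\rho)\,e^{4M/(nL)},\qquad \omega=\log\mathcal E .$$ The product converges and $\mathcal E>0$ for all $x\in\mathbb R$, $\rho>0$. There is a constant $C>0$ (depending only on $M$ and $L$) such that, as $\rho\to\infty$ and uniformly in $x\in\mathbb R$, $$\mathcal E(x,\rho)=C\rho^{4M/L}\,(1+o(1)),\qquad\text{equivalently}\qquad \omega(x,\rho)=\frac{2M}{L}\log\rho^2+\log C+o(1).$$ Moreover, the system $$k_\rho=\tfrac{\rho}{4}(\omega_\rho^2-\omega_x^2),\qquad k_x=\tfrac{\rho}{2}\,\omega_x\omega_\rho$$ has a solution $k$ on $\{\rho>0\}$, and for every solution $k$ the metric $$ds^2=e^{-\omega}\big[e^{2k}(dx^2+d\rho^2)+\rho^2d\phi^2\big]-e^{\omega}dt^2$$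 approaches a Kasner metric with index $\alpha=4M/L$: there is a constant $\tilde C>0$ such that, as $\rho\to\infty$, each component of $ds^2$ in the coordinates $(x,\rho,\phi,t)$ equals the corresponding component of $$\tilde C\rho^{\alpha^2/2-\alpha}(dx^2+d\rho^2)+C^{-1}\rho^{2-\alpha}d\phi^2-C\rho^{\alpha}dt^2$$ times $1+o(1)$, uniformly in $x$. -/

import Mathlib

open Filter

noncomputable section

namespace PeriodicSchwarzschild

/-- Ernst potential of the Schwarzschild solution of mass `M` in Weyl canonical coordinates
`(x, ρ)`. -/
def ernst₀ (M x ρ : ℝ) : ℝ :=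
  (√((x - M) ^ 2 + ρ ^ 2) + √((x + M) ^ 2 + ρ ^ 2) - 2 * M) /
    (√((x - M) ^ 2 + ρ ^ 2) + √((x + M) ^ 2 + ρ ^ 2) + 2 * M)

/-- The factor with index `n` (to be used with `n ≥ 1`) of the infinite product that defines the
periodic Ernst potential. -/
def ernstFactor (M L x ρ : ℝ) (n : ℕ) : ℝ :=
  ernst₀ M (x + n * L) ρ * ernst₀ M (x - n * L) ρ * Real.exp (4 * M / (n * L))

/-- Ernst potential of the periodic analog, with period `L` in `x`, of the Schwarzschild solution
of mass `M`. -/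
def ernst (M L x ρ : ℝ) : ℝ :=
  ernst₀ M x ρ * ∏' n : ℕ, ernstFactor M L x ρ (n + 1)

/-- The logarithm `ω` of the periodic Ernst potential. -/
def omega (M L x ρ : ℝ) : ℝ := Real.log (ernst M L x ρ)

/-- `k` is a conformal factor for the static potential `ω`: on the half-plane `ρ > 0` the partial
derivatives of `ω` and of `k` exist, and
`k_ρ = (ρ / 4) (ω_ρ ^ 2 - ω_x ^ 2)` and `k_x = (ρ / 2) ω_x ω_ρ`. -/
def IsConformalFactor (ω k : ℝ → ℝ → ℝ) : Prop :=
  ∀ x ρ : ℝ, 0 < ρ → ∃ ωx ωρ : ℝ,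
    HasDerivAt (fun y => ω y ρ) ωx x ∧ HasDerivAt (fun r => ω x r) ωρ ρ ∧
    HasDerivAt (fun r => k x r) (ρ / 4 * (ωρ ^ 2 - ωx ^ 2)) ρ ∧
    HasDerivAt (fun y => k y ρ) (ρ / 2 * ωx * ωρ) x

/-- Components, in the coordinates `(x, ρ, φ, t)`, of the static axisymmetric metric
`e^{-ω} [e^{2k} (dx² + dρ²) + ρ² dφ²] - e^ω dt²`. -/
def weylMetric (ω k : ℝ → ℝ → ℝ) (x ρ : ℝ) : Matrix (Fin 4) (Fin 4) ℝ :=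
  Matrix.diagonal
    ![Real.exp (-ω x ρ) * Real.exp (2 * k x ρ), Real.exp (-ω x ρ) * Real.exp (2 * k x ρ),
      Real.exp (-ω x ρ) * ρ ^ 2, -Real.exp (ω x ρ)]

/-- Components, in the coordinates `(x, ρ, φ, t)`, of the Kasner metric
`C' ρ^{α²/2 - α} (dx² + dρ²) + C⁻¹ ρ^{2 - α} dφ² - C ρ^α dt²` with index `α`. -/
def kasnerMetric (α C C' ρ : ℝ) : Matrix (Fin 4) (Fin 4) ℝ :=
  Matrix.diagonal
    ![C' * ρ ^ (α ^ 2 / 2 - α), C' * ρ ^ (α ^ 2 / 2 - α), C⁻¹ * ρ ^ (2 - α), -(C * ρ ^ α)]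

/-- `f(x, ρ) = g(ρ) (1 + o(1))` as `ρ → ∞`, uniformly in `x`. -/
def IsAsymptotic (f : ℝ → ℝ → ℝ) (g : ℝ → ℝ) : Prop :=
  ∃ δ : ℝ → ℝ → ℝ, TendstoUniformly (fun ρ x => δ x ρ) (fun _ => 0) atTop ∧
    ∀ x ρ : ℝ, 0 < ρ → f x ρ = g ρ * (1 + δ x ρ)

end PeriodicSchwarzschild

end

open PeriodicSchwarzschild

/-! The logarithm of `ernst₀` is the potential of a uniform rod, `arsinh ((x - M) / ρ) - arsinh ((x
+ M) / ρ)`, that is `rodDiff M kernel` (`ernst₀_eq_exp`). Hence `ω` is the sum of the translates of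
this potential over `L ℤ`. Each translate decays only like `-2M / |nL|`, and the exponential factors
of the product, shared equally between `n` and `-n`, cancel exactly this tail. The derivatives of
the rod potential decay like the inverse square of the distance, so the sum may be differentiated
termwise (`HasGrad.lattice`) and `ω` stays axisymmetric harmonic.

For large `ρ` a lattice sum of a derivative is a Riemann sum: it is `1 / L` times the integral over
the line, up to `O(ρ ^ (-3/2))` uniformly in `x` (`exists_abs_latticeSum_sub_le`). The integral is
`0` for `ω_x` and `4M / ρ` for `ω_ρ`, so with `α = 4M / L` one has `ω_x = O(ρ ^ (-3/2))` and `ω_ρ =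
α / ρ + O(ρ ^ (-3/2))`. The error is integrable at infinity, so `ω - α log ρ` converges, and the
decay of `ω_x` makes the limit independent of `x` (`exists_tendstoUniformly_sub_log`).

The form `k_x dx + k_ρ dρ` is closed because `ω` is harmonic, so `k` exists on the half-plane.
Inserting the estimates gives `k_ρ = α² / (4ρ) + O(ρ ^ (-3/2))`, and the same integration lemma
applies to `k`. Exponentiating yields the Kasner components. -/

namespace PeriodicSchwarzschild

/-! ### The kernel `arsinh (u / ρ)` and its derivatives -/

/-- The distance to the origin in the half-plane `{(u, ρ) | ρ > 0}`. -/
noncomputable def radius (u ρ : ℝ) : ℝ := √(u ^ 2 + ρ ^ 2)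

/-- The linear form `a dx + b dρ`. -/
noncomputable def gradForm (a b : ℝ) : ℝ × ℝ →L[ℝ] ℝ :=
  a • ContinuousLinearMap.fst ℝ ℝ ℝ + b • ContinuousLinearMap.snd ℝ ℝ ℝ

@[simp]
theorem gradForm_apply (a b : ℝ) (v : ℝ × ℝ) : gradForm a b v = a * v.1 + b * v.2 := by
  simp [gradForm]

theorem norm_gradForm_le (a b : ℝ) : ‖gradForm a b‖ ≤ |a| + |b| := by
  refine ContinuousLinearMap.opNorm_le_bound _ (by positivity) fun v => ?_
  rw [gradForm_apply, Real.norm_eq_abs]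
  calc |a * v.1 + b * v.2| ≤ |a * v.1| + |b * v.2| := abs_add_le _ _
    _ = |a| * ‖v.1‖ + |b| * ‖v.2‖ := by rw [abs_mul, abs_mul]; rfl
    _ ≤ |a| * ‖v‖ + |b| * ‖v‖ := by
      gcongr
      · exact norm_fst_le v
      · exact norm_snd_le v
    _ = (|a| + |b|) * ‖v‖ := by ring

theorem radius_pos (u : ℝ) {ρ : ℝ} (hρ : 0 < ρ) : 0 < radius u ρ :=
  Real.sqrt_pos.2 (by positivity)

theorem radius_sq (u ρ : ℝ) : radius u ρ ^ 2 = u ^ 2 + ρ ^ 2 :=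
  Real.sq_sqrt (by positivity)

theorem abs_le_radius (u ρ : ℝ) : |u| ≤ radius u ρ :=
  Real.abs_le_sqrt (by nlinarith [sq_nonneg ρ])

theorem le_radius (u ρ : ℝ) : ρ ≤ radius u ρ :=
  Real.le_sqrt_of_sq_le (by nlinarith [sq_nonneg u])

theorem radius_neg (u ρ : ℝ) : radius (-u) ρ = radius u ρ := by simp [radius]

theorem hasFDerivAt_radius (u : ℝ) {ρ : ℝ} (hρ : 0 < ρ) :
    HasFDerivAt (fun z : ℝ × ℝ => radius z.1 z.2)
      (gradForm (u / radius u ρ) (ρ / radius u ρ)) (u, ρ) := by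
  have h1 : HasFDerivAt (fun z : ℝ × ℝ => z.1) (ContinuousLinearMap.fst ℝ ℝ ℝ) (u, ρ) :=
    hasFDerivAt_fst
  have h2 : HasFDerivAt (fun z : ℝ × ℝ => z.2) (ContinuousLinearMap.snd ℝ ℝ ℝ) (u, ρ) :=
    hasFDerivAt_snd
  have h := ((h1.pow 2).add (h2.pow 2)).sqrt (x := (u, ρ)) (by simp; positivity)
  refine h.congr_fderiv ?_
  have hR := (radius_pos u hρ).ne'
  change √(u ^ 2 + ρ ^ 2) ≠ 0 at hR
  ext <;> simp [gradForm, radius] <;> field_simp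

/-- The elementary potential `arsinh (u / ρ)`, a primitive in `u` of the Newtonian potential. -/
noncomputable def kernel (u ρ : ℝ) : ℝ := Real.arsinh (u / ρ)

/-- The derivative of `kernel` in the first variable. -/
noncomputable def kernelX (u ρ : ℝ) : ℝ := 1 / radius u ρ

/-- The derivative of `kernel` in the second variable. -/
noncomputable def kernelR (u ρ : ℝ) : ℝ := -u / (ρ * radius u ρ)

/-- The second derivative of `kernel` in the first variable. -/
noncomputable def kernelXX (u ρ : ℝ) : ℝ := -u / radius u ρ ^ 3

/-- The mixed second derivative of `kernel`. -/
noncomputable def kernelXR (u ρ : ℝ) : ℝ := -ρ / radius u ρ ^ 3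

/-- The second derivative of `kernel` in the second variable. -/
noncomputable def kernelRR (u ρ : ℝ) : ℝ := -(1 / ρ) * kernelR u ρ - kernelXX u ρ

theorem radius_div (u : ℝ) {ρ : ℝ} (hρ : 0 < ρ) : √(1 + (u / ρ) ^ 2) = radius u ρ / ρ := by
  rw [radius, eq_div_iff hρ.ne', ← Real.sqrt_sq hρ.le, ← Real.sqrt_mul (by positivity),
    Real.sqrt_sq hρ.le]
  congr 1
  field_simp
  ring

theorem hasFDerivAt_kernel (u : ℝ) {ρ : ℝ} (hρ : 0 < ρ) :
    HasFDerivAt (fun z : ℝ × ℝ => kernel z.1 z.2)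
      (gradForm (kernelX u ρ) (kernelR u ρ)) (u, ρ) := by
  have h1 : HasFDerivAt (fun z : ℝ × ℝ => z.1) (ContinuousLinearMap.fst ℝ ℝ ℝ) (u, ρ) :=
    hasFDerivAt_fst
  have h2 : HasFDerivAt (fun z : ℝ × ℝ => z.2) (ContinuousLinearMap.snd ℝ ℝ ℝ) (u, ρ) :=
    hasFDerivAt_snd
  have h := (h1.mul ((hasDerivAt_inv hρ.ne').comp_hasFDerivAt (u, ρ) h2)).arsinh
  refine (h.congr_fderiv ?_).congr_of_eventuallyEq (.of_forall fun z => by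
    simp [kernel, div_eq_mul_inv])
  have hR := (radius_pos u hρ).ne'
  ext <;> simp [gradForm, kernelX, kernelR, ← div_eq_mul_inv, radius_div u hρ] <;> field_simp

theorem hasFDerivAt_kernelX (u : ℝ) {ρ : ℝ} (hρ : 0 < ρ) :
    HasFDerivAt (fun z : ℝ × ℝ => kernelX z.1 z.2)
      (gradForm (kernelXX u ρ) (kernelXR u ρ)) (u, ρ) := by
  have hR := (radius_pos u hρ).ne'
  have h := (hasDerivAt_inv hR).comp_hasFDerivAt (f := fun z : ℝ × ℝ => radius z.1 z.2) (u, ρ)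
    (hasFDerivAt_radius u hρ)
  simp only [kernelX, one_div]
  refine h.congr_fderiv ?_
  ext <;> simp [gradForm, kernelXX, kernelXR] <;> field_simp

/-- Since `kernelRR` is defined by solving the axisymmetric Laplace equation for it, the second
component says that `kernel` is harmonic. -/
theorem hasFDerivAt_kernelR (u : ℝ) {ρ : ℝ} (hρ : 0 < ρ) :
    HasFDerivAt (fun z : ℝ × ℝ => kernelR z.1 z.2)
      (gradForm (kernelXR u ρ) (kernelRR u ρ)) (u, ρ) := by
  have hR := (radius_pos u hρ).ne'
  have h1 : HasFDerivAt (fun z : ℝ × ℝ => z.1) (ContinuousLinearMap.fst ℝ ℝ ℝ) (u, ρ) :=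
    hasFDerivAt_fst
  have h2 : HasFDerivAt (fun z : ℝ × ℝ => z.2) (ContinuousLinearMap.snd ℝ ℝ ℝ) (u, ρ) :=
    hasFDerivAt_snd
  have h3 : HasFDerivAt (fun z : ℝ × ℝ => z.2 * radius z.1 z.2) _ (u, ρ) :=
    h2.mul (hasFDerivAt_radius u hρ)
  have h := h1.neg.mul
    ((hasDerivAt_inv (x := ρ * radius u ρ) (mul_ne_zero hρ.ne' hR)).comp_hasFDerivAt (u, ρ) h3)
  refine (h.congr_fderiv ?_).congr_of_eventuallyEq (.of_forall fun z => by
    simp [kernelR, div_eq_mul_inv])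
  have hsq := radius_sq u ρ
  have hρ' := hρ.ne'
  ext
  · simp [gradForm, kernelXR]
    field_simp
    linear_combination (-1) * hsq
  · simp [gradForm, kernelRR, kernelR, kernelXX]
    field_simp
    ring

theorem hasDerivAt_radius (u : ℝ) {ρ : ℝ} (hρ : 0 < ρ) :
    HasDerivAt (fun v => radius v ρ) (u / radius u ρ) u := by
  have h := (hasFDerivAt_radius u hρ).comp_hasDerivAt u
    ((hasDerivAt_id u).prodMk (hasDerivAt_const u ρ))
  simpa [Function.comp_def] using h

theorem hasDerivAt_kernelXX (u : ℝ) {ρ : ℝ} (hρ : 0 < ρ) :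
    HasDerivAt (fun v => kernelXX v ρ) ((2 * u ^ 2 - ρ ^ 2) / radius u ρ ^ 5) u := by
  have hR := (radius_pos u hρ).ne'
  have h := (hasDerivAt_id u).neg.div ((hasDerivAt_radius u hρ).pow 3) (pow_ne_zero 3 hR)
  refine h.congr_deriv ?_
  have hsq := radius_sq u ρ
  simp
  field_simp
  linear_combination (-1) * hsq

theorem hasDerivAt_kernelXR (u : ℝ) {ρ : ℝ} (hρ : 0 < ρ) :
    HasDerivAt (fun v => kernelXR v ρ) (3 * ρ * u / radius u ρ ^ 5) u := by
  have hR := (radius_pos u hρ).ne'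
  have h := (hasDerivAt_const u (-ρ)).div ((hasDerivAt_radius u hρ).pow 3) (pow_ne_zero 3 hR)
  refine h.congr_deriv ?_
  simp
  field_simp

theorem abs_kernelXX_le (u : ℝ) {ρ : ℝ} (hρ : 0 < ρ) :
    |kernelXX u ρ| ≤ 1 / (u ^ 2 + ρ ^ 2) := by
  have hR := radius_pos u hρ
  rw [kernelXX, abs_div, abs_neg, abs_of_pos (pow_pos hR 3), ← radius_sq,
    div_le_div_iff₀ (by positivity) (by positivity)]
  nlinarith [mul_le_mul_of_nonneg_right (abs_le_radius u ρ) (pow_pos hR 2).le]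

theorem abs_kernelXR_le (u : ℝ) {ρ : ℝ} (hρ : 0 < ρ) :
    |kernelXR u ρ| ≤ 1 / (u ^ 2 + ρ ^ 2) := by
  have hR := radius_pos u hρ
  rw [kernelXR, abs_div, abs_neg, abs_of_pos (pow_pos hR 3), ← radius_sq,
    div_le_div_iff₀ (by positivity) (by positivity), abs_of_pos hρ]
  nlinarith [mul_le_mul_of_nonneg_right (le_radius u ρ) (pow_pos hR 2).le]

/-- The kernel is homogeneous of degree `0`, so its third derivatives have degree `-3`. -/
theorem abs_deriv_kernelXX_le (u : ℝ) {ρ : ℝ} (hρ : 0 < ρ) :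
    |(2 * u ^ 2 - ρ ^ 2) / radius u ρ ^ 5| ≤ 3 / radius u ρ ^ 3 := by
  have hR := radius_pos u hρ
  rw [abs_div, abs_of_pos (pow_pos hR 5), div_le_div_iff₀ (by positivity) (by positivity)]
  have h : |2 * u ^ 2 - ρ ^ 2| ≤ 3 * radius u ρ ^ 2 := by
    rw [radius_sq, abs_le]
    constructor <;> nlinarith [sq_nonneg u, sq_nonneg ρ]
  calc _ ≤ 3 * radius u ρ ^ 2 * radius u ρ ^ 3 := by gcongr
    _ = _ := by ring

theorem abs_deriv_kernelXR_le (u : ℝ) {ρ : ℝ} (hρ : 0 < ρ) :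
    |3 * ρ * u / radius u ρ ^ 5| ≤ 3 / radius u ρ ^ 3 := by
  have hR := radius_pos u hρ
  rw [abs_div, abs_of_pos (pow_pos hR 5), div_le_div_iff₀ (by positivity) (by positivity)]
  have h : |3 * ρ * u| ≤ 3 * radius u ρ ^ 2 := by
    rw [radius_sq, abs_le]
    constructor <;> nlinarith [sq_nonneg (u - ρ), sq_nonneg (u + ρ)]
  calc _ ≤ 3 * radius u ρ ^ 2 * radius u ρ ^ 3 := by gcongr
    _ = _ := by ring

/-! ### Decay estimates and termwise differentiation of lattice sums -/

/-- On the half-plane `ρ > 0` the function `F` is differentiable with partial derivatives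
`F₁` and `F₂`. -/
def HasGrad (F F₁ F₂ : ℝ → ℝ → ℝ) : Prop :=
  ∀ x ρ : ℝ, 0 < ρ →
    HasFDerivAt (fun z : ℝ × ℝ => F z.1 z.2) (gradForm (F₁ x ρ) (F₂ x ρ)) (x, ρ)

/-- `F` is bounded by a multiple of `1 / (x² + ρ²)` on every half-plane `ρ ≥ a > 0`. -/
def DecaysSq (F : ℝ → ℝ → ℝ) : Prop :=
  ∀ a : ℝ, 0 < a → ∃ K : ℝ, ∀ x ρ : ℝ, a ≤ ρ → |F x ρ| ≤ K / (x ^ 2 + ρ ^ 2)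

/-- The difference of `F` between the end points of the rod `[x - M, x + M]`. -/
def rodDiff (M : ℝ) (F : ℝ → ℝ → ℝ) (x ρ : ℝ) : ℝ := F (x - M) ρ - F (x + M) ρ

/-- The sum over the lattice `L ℤ` of the translates of `F`, renormalized by constants `c n`. -/
noncomputable def latticeSum (L : ℝ) (c : ℤ → ℝ) (F : ℝ → ℝ → ℝ) (x ρ : ℝ) : ℝ :=
  ∑' n : ℤ, (c n + F (x + n * L) ρ)

section Grad

variable {F F₁ F₂ : ℝ → ℝ → ℝ}

theorem HasGrad.hasDerivAt_fst (h : HasGrad F F₁ F₂) (x : ℝ) {ρ : ℝ} (hρ : 0 < ρ) :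
    HasDerivAt (fun y => F y ρ) (F₁ x ρ) x := by
  simpa [Function.comp_def] using
    (h x ρ hρ).comp_hasDerivAt x ((hasDerivAt_id x).prodMk (hasDerivAt_const x ρ))

theorem HasGrad.hasDerivAt_snd (h : HasGrad F F₁ F₂) (x : ℝ) {ρ : ℝ} (hρ : 0 < ρ) :
    HasDerivAt (fun r => F x r) (F₂ x ρ) ρ := by
  simpa [Function.comp_def] using
    (h x ρ hρ).comp_hasDerivAt ρ ((hasDerivAt_const ρ x).prodMk (hasDerivAt_id ρ))

theorem HasGrad.translate (h : HasGrad F F₁ F₂) (s : ℝ) :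
    HasGrad (fun x ρ => F (x + s) ρ) (fun x ρ => F₁ (x + s) ρ) (fun x ρ => F₂ (x + s) ρ) := by
  intro x ρ hρ
  have h' := (hasFDerivAt_comp_add_right (f := fun z : ℝ × ℝ => F z.1 z.2) (x := (x, ρ))
    (f' := gradForm (F₁ (x + s) ρ) (F₂ (x + s) ρ)) (s, 0)).2 (by simpa using h (x + s) ρ hρ)
  simpa using h'

theorem HasGrad.rodDiff (h : HasGrad F F₁ F₂) (M : ℝ) :
    HasGrad (rodDiff M F) (rodDiff M F₁) (rodDiff M F₂) := by
  intro x ρ hρ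
  refine ((h.translate (-M) x ρ hρ).sub (h.translate M x ρ hρ)).congr_fderiv ?_
  ext <;> simp [PeriodicSchwarzschild.rodDiff, sub_eq_add_neg]

/-- The cost `2 s²` of a bounded shift is absorbed by `ρ²`, which is bounded below. -/
theorem sq_add_sq_le_mul_translate {M a x s ρ : ℝ} (ha : 0 < a) (hs : |s| ≤ M) (hρ : a ≤ ρ) :
    x ^ 2 + ρ ^ 2 ≤ (2 + 2 * (M / a) ^ 2) * ((x + s) ^ 2 + ρ ^ 2) := by
  have h1 : s ^ 2 ≤ M ^ 2 := sq_le_sq' (by linarith [neg_abs_le s]) ((le_abs_self s).trans hs)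
  have h2 : M ^ 2 ≤ (M / a) ^ 2 * ρ ^ 2 := by
    have : M ^ 2 = (M / a) ^ 2 * a ^ 2 := by field_simp
    rw [this]
    gcongr
  have h3 : 0 ≤ (M / a) ^ 2 * (x + s) ^ 2 := by positivity
  nlinarith [sq_nonneg (x + 2 * s), sq_nonneg ρ]

theorem div_translate_le {M a x s ρ K : ℝ} (hK : 0 ≤ K) (ha : 0 < a) (hs : |s| ≤ M)
    (hρ : a ≤ ρ) :
    K / ((x + s) ^ 2 + ρ ^ 2) ≤ K * (2 + 2 * (M / a) ^ 2) / (x ^ 2 + ρ ^ 2) := by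
  have hρ0 := ha.trans_le hρ
  rw [div_le_div_iff₀ (by positivity) (by positivity), mul_assoc]
  gcongr
  exact sq_add_sq_le_mul_translate ha hs hρ

theorem DecaysSq.exists_nonneg (h : DecaysSq F) {a : ℝ} (ha : 0 < a) :
    ∃ K : ℝ, 0 ≤ K ∧ ∀ x ρ : ℝ, a ≤ ρ → |F x ρ| ≤ K / (x ^ 2 + ρ ^ 2) := by
  obtain ⟨K, hK⟩ := h a ha
  refine ⟨|K|, abs_nonneg K, fun x ρ hρ => (hK x ρ hρ).trans ?_⟩
  gcongr
  exact le_abs_self K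

theorem DecaysSq.rodDiff (h : DecaysSq F) {M : ℝ} (hM : 0 < M) :
    DecaysSq (rodDiff M F) := by
  intro a ha
  obtain ⟨K, hK0, hK⟩ := h.exists_nonneg ha
  refine ⟨K * (2 + 2 * (M / a) ^ 2) + K * (2 + 2 * (M / a) ^ 2), fun x ρ hρ => ?_⟩
  have hM' : |-M| ≤ M := by rw [abs_neg, abs_of_pos hM]
  have h1 := (hK (x + -M) ρ hρ).trans (div_translate_le hK0 ha hM' hρ)
  have h2 := (hK (x + M) ρ hρ).trans (div_translate_le hK0 ha (abs_of_pos hM).le hρ)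
  rw [add_div]
  exact (abs_sub _ _).trans (add_le_add h1 h2)

/-- A mean value bound for `rodDiff`. -/
theorem abs_rodDiff_le {f f' : ℝ → ℝ} {M x B : ℝ} (hM : 0 < M)
    (hf : ∀ u, HasDerivAt f (f' u) u) (hB : ∀ s, |s| ≤ M → |f' (x + s)| ≤ B) :
    |f (x - M) - f (x + M)| ≤ B * (2 * M) := by
  have h := (convex_Icc (x - M) (x + M)).norm_image_sub_le_of_norm_hasDerivWithin_le
    (f := f) (f' := f') (C := B) (fun u _ => (hf u).hasDerivWithinAt) (fun u hu => ?_)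
    (Set.right_mem_Icc.2 (by linarith)) (Set.left_mem_Icc.2 (by linarith))
  · have e : ‖x - M - (x + M)‖ = 2 * M := by
      rw [show x - M - (x + M) = -(2 * M) by ring, norm_neg, Real.norm_eq_abs,
        abs_of_pos (by linarith)]
    rwa [e] at h
  · have := hB (u - x) (abs_le.2 ⟨by linarith [hu.1], by linarith [hu.2]⟩)
    rwa [add_sub_cancel] at this

/-- By the mean value theorem a difference over the rod inherits the decay of the `x`-derivative;
this gains the order that `kernelX` and `kernelR` lack. -/
theorem HasGrad.decaysSq_rodDiff (h : HasGrad F F₁ F₂) (h₁ : DecaysSq F₁) {M : ℝ} (hM : 0 < M) :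
    DecaysSq (PeriodicSchwarzschild.rodDiff M F) := by
  intro a ha
  obtain ⟨K, hK0, hK⟩ := h₁.exists_nonneg ha
  refine ⟨K * (2 + 2 * (M / a) ^ 2) * (2 * M), fun x ρ hρ => ?_⟩
  rw [mul_div_right_comm]
  exact abs_rodDiff_le hM (fun u => h.hasDerivAt_fst u (ha.trans_le hρ))
    fun s hs => (hK _ ρ hρ).trans (div_translate_le hK0 ha hs hρ)

theorem summable_one_div_one_add_int_sq : Summable fun n : ℤ => 1 / (1 + (n : ℝ) ^ 2) := by
  refine Summable.of_norm_bounded_eventually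
    ((Real.summable_one_div_int_pow (p := 2)).2 one_lt_two) ?_
  filter_upwards [(Set.finite_singleton (0 : ℤ)).compl_mem_cofinite] with n hn
  have hn' : (n : ℝ) ≠ 0 := by exact_mod_cast hn
  rw [Real.norm_eq_abs, abs_of_pos (by positivity)]
  gcongr
  linarith

/-- A summable majorant, uniform for `|x| ≤ X` and `ρ ≥ a`, as the Weierstrass test requires. -/
theorem div_lattice_le {L a X x ρ K : ℝ} (hL : 0 < L) (ha : 0 < a) (hx : |x| ≤ X) (hρ : a ≤ ρ)
    (hK : 0 ≤ K) (n : ℤ) :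
    K / ((x + n * L) ^ 2 + ρ ^ 2) ≤
      K * ((1 / a) ^ 2 + (2 + 2 * (X / a) ^ 2) * (1 / L) ^ 2) * (1 / (1 + (n : ℝ) ^ 2)) := by
  have hρ0 := ha.trans_le hρ
  rw [mul_one_div, div_le_div_iff₀ (by positivity) (by positivity), mul_assoc]
  gcongr
  have h1 := sq_add_sq_le_mul_translate (x := n * L) (s := x) ha hx hρ
  rw [add_comm _ x] at h1
  have h2 : (n : ℝ) ^ 2 = (1 / L) ^ 2 * (n * L) ^ 2 := by field_simp
  have h3 : 1 ≤ (1 / a) ^ 2 * ρ ^ 2 := by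
    have : (1 : ℝ) = (1 / a) ^ 2 * a ^ 2 := by field_simp
    calc 1 = (1 / a) ^ 2 * a ^ 2 := this
      _ ≤ _ := by gcongr
  have h4 : 0 ≤ (1 / a) ^ 2 * (x + n * L) ^ 2 := by positivity
  have h5 := mul_le_mul_of_nonneg_left h1 (sq_nonneg (1 / L))
  have h6 : 0 ≤ (1 / L) ^ 2 * ρ ^ 2 := by positivity
  linarith

theorem DecaysSq.summable (h : DecaysSq F) {L : ℝ} (hL : 0 < L) (x : ℝ) {ρ : ℝ} (hρ : 0 < ρ) :
    Summable fun n : ℤ => F (x + n * L) ρ := by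
  obtain ⟨K, hK0, hK⟩ := h.exists_nonneg hρ
  refine Summable.of_norm_bounded (summable_one_div_one_add_int_sq.mul_left _) fun n =>
    (hK _ ρ le_rfl).trans (div_lattice_le hL hρ le_rfl le_rfl hK0 n)

/-- Uniformly summable gradients on a connected open set carry summability from one point to the
whole set, so the renormalized series need only be checked at `(0, 1)`. -/
theorem HasGrad.lattice {L : ℝ} {c : ℤ → ℝ} (h : HasGrad F F₁ F₂) (h₁ : DecaysSq F₁)
    (h₂ : DecaysSq F₂) (hL : 0 < L) (hc : Summable fun n : ℤ => c n + F (0 + n * L) 1) :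
    (∀ x ρ : ℝ, 0 < ρ → Summable fun n : ℤ => c n + F (x + n * L) ρ) ∧
      HasGrad (latticeSum L c F) (latticeSum L 0 F₁) (latticeSum L 0 F₂) := by
  have main : ∀ x ρ : ℝ, 0 < ρ → (Summable fun n : ℤ => c n + F (x + n * L) ρ) ∧
      HasFDerivAt (fun z : ℝ × ℝ => ∑' n : ℤ, (c n + F (z.1 + n * L) z.2))
        (∑' n : ℤ, gradForm (F₁ (x + n * L) ρ) (F₂ (x + n * L) ρ)) (x, ρ) := by
    intro x ρ hρ
    -- With this `a` and `X`, the convex region `s` contains both `(x, ρ)` and the base point `(0,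
    -- 1)`.
    set a := min ρ 1 / 2 with ha_def
    have ha : 0 < a := by positivity
    have haρ : a < ρ := by linarith [min_le_left ρ 1]
    have ha1 : a < 1 := by linarith [min_le_right ρ 1]
    set X := |x| + 1 with hX_def
    have hX : 0 < X := by positivity
    obtain ⟨K₁, hK₁0, hK₁⟩ := h₁.exists_nonneg ha
    obtain ⟨K₂, hK₂0, hK₂⟩ := h₂.exists_nonneg ha
    set s : Set (ℝ × ℝ) := Set.Ioo (-X) X ×ˢ Set.Ioi a with hs_def
    have hs : IsOpen s := isOpen_Ioo.prod isOpen_Ioi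
    have hs' : IsPreconnected s := ((convex_Ioo _ _).prod (convex_Ioi _)).isPreconnected
    set D := (1 / a) ^ 2 + (2 + 2 * (X / a) ^ 2) * (1 / L) ^ 2
    have hu : Summable fun n : ℤ => (K₁ + K₂) * D * (1 / (1 + (n : ℝ) ^ 2)) :=
      summable_one_div_one_add_int_sq.mul_left _
    have hf : ∀ (n : ℤ) (z : ℝ × ℝ), z ∈ s →
        HasFDerivAt (fun z : ℝ × ℝ => c n + F (z.1 + n * L) z.2)
          (gradForm (F₁ (z.1 + n * L) z.2) (F₂ (z.1 + n * L) z.2)) z := fun n z hz =>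
      (h.translate (n * L) z.1 z.2 (ha.trans hz.2)).const_add (c n)
    have hf' : ∀ (n : ℤ) (z : ℝ × ℝ), z ∈ s →
        ‖gradForm (F₁ (z.1 + n * L) z.2) (F₂ (z.1 + n * L) z.2)‖ ≤
          (K₁ + K₂) * D * (1 / (1 + (n : ℝ) ^ 2)) := by
      intro n z hz
      have hz1 : |z.1| ≤ X := abs_le.2 ⟨hz.1.1.le, hz.1.2.le⟩
      have hz2 : a ≤ z.2 := (Set.mem_Ioi.1 hz.2).le
      calc _ ≤ _ := norm_gradForm_le _ _
        _ ≤ K₁ * D * (1 / (1 + (n : ℝ) ^ 2)) + K₂ * D * (1 / (1 + (n : ℝ) ^ 2)) :=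
          add_le_add ((hK₁ _ _ hz2).trans (div_lattice_le hL ha hz1 hz2 hK₁0 n))
            ((hK₂ _ _ hz2).trans (div_lattice_le hL ha hz1 hz2 hK₂0 n))
        _ = _ := by ring
    have hz₀ : ((0 : ℝ), (1 : ℝ)) ∈ s := ⟨⟨by simpa using hX, hX⟩, ha1⟩
    have hz : (x, ρ) ∈ s :=
      ⟨⟨by simp only []; linarith [neg_abs_le x], by simp only []; linarith [le_abs_self x]⟩, haρ⟩
    have h₁ := summable_of_summable_hasFDerivAt_of_isPreconnected
      (f := fun (n : ℤ) (z : ℝ × ℝ) => c n + F (z.1 + n * L) z.2)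
      (f' := fun (n : ℤ) (z : ℝ × ℝ) => gradForm (F₁ (z.1 + n * L) z.2) (F₂ (z.1 + n * L) z.2))
      hu hs hs' hf hf' hz₀ hc hz
    have h₂ := hasFDerivAt_tsum_of_isPreconnected
      (f := fun (n : ℤ) (z : ℝ × ℝ) => c n + F (z.1 + n * L) z.2)
      (f' := fun (n : ℤ) (z : ℝ × ℝ) => gradForm (F₁ (z.1 + n * L) z.2) (F₂ (z.1 + n * L) z.2))
      hu hs hs' hf hf' hz₀ hc hz
    exact ⟨h₁, h₂⟩
  refine ⟨fun x ρ hρ => (main x ρ hρ).1, fun x ρ hρ => (main x ρ hρ).2.congr_fderiv ?_⟩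
  have s₁ := (h₁.summable hL x hρ).hasSum
  have s₂ := (h₂.summable hL x hρ).hasSum
  have := (s₁.smul_const (ContinuousLinearMap.fst ℝ ℝ ℝ)).add
    (s₂.smul_const (ContinuousLinearMap.snd ℝ ℝ ℝ))
  simpa [latticeSum, gradForm] using this.tsum_eq

end Grad

/-! ### The potential of a single rod -/

theorem hasGrad_kernel : HasGrad kernel kernelX kernelR := fun u _ hρ => hasFDerivAt_kernel u hρ

theorem hasGrad_kernelX : HasGrad kernelX kernelXX kernelXR :=
  fun u _ hρ => hasFDerivAt_kernelX u hρ

theorem hasGrad_kernelR : HasGrad kernelR kernelXR kernelRR :=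
  fun u _ hρ => hasFDerivAt_kernelR u hρ

theorem decaysSq_kernelXX : DecaysSq kernelXX :=
  fun _ ha => ⟨1, fun u _ hρ => abs_kernelXX_le u (ha.trans_le hρ)⟩

theorem decaysSq_kernelXR : DecaysSq kernelXR :=
  fun _ ha => ⟨1, fun u _ hρ => abs_kernelXR_le u (ha.trans_le hρ)⟩

theorem rodDiff_kernelRR (M x ρ : ℝ) :
    rodDiff M kernelRR x ρ = -(1 / ρ) * rodDiff M kernelR x ρ - rodDiff M kernelXX x ρ := by
  simp only [rodDiff, kernelRR]
  ring

section Rod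

variable {M : ℝ}

theorem decaysSq_rodDiff_kernelX (hM : 0 < M) : DecaysSq (rodDiff M kernelX) :=
  hasGrad_kernelX.decaysSq_rodDiff decaysSq_kernelXX hM

theorem decaysSq_rodDiff_kernelR (hM : 0 < M) : DecaysSq (rodDiff M kernelR) :=
  hasGrad_kernelR.decaysSq_rodDiff decaysSq_kernelXR hM

theorem decaysSq_rodDiff_kernelRR (hM : 0 < M) : DecaysSq (rodDiff M kernelRR) := by
  intro a ha
  obtain ⟨K, hK0, hK⟩ := (decaysSq_rodDiff_kernelR hM).exists_nonneg ha
  obtain ⟨K', hK'⟩ := (decaysSq_kernelXX.rodDiff hM) a ha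
  refine ⟨1 / a * K + K', fun x ρ hρ => ?_⟩
  have hρ0 := ha.trans_le hρ
  rw [rodDiff_kernelRR, add_div, mul_div_assoc]
  refine (abs_sub _ _).trans (add_le_add ?_ (hK' x ρ hρ))
  rw [abs_mul, abs_neg, abs_of_pos (by positivity)]
  exact mul_le_mul (one_div_le_one_div_of_le ha hρ) (hK x ρ hρ) (abs_nonneg _) (by positivity)

/-- The mean value theorem gives `-2M / radius ξ 1` with `ξ` within `M` of `u`; as `radius ξ 1`
differs from `|u|` by at most `M + 1`, the leading terms cancel. -/
theorem abs_rodDiff_kernel_add_le (hM : 0 < M) {u : ℝ} (hu : 2 * M ≤ |u|) :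
    |2 * M / |u| + rodDiff M kernel u 1| ≤ 4 * M * (M + 1) / u ^ 2 := by
  have hu0 : 0 < |u| := by linarith
  obtain ⟨ξ, hξ, e⟩ := exists_hasDerivAt_eq_slope (fun v => kernel v 1) (fun v => kernelX v 1)
    (a := u - M) (b := u + M) (by linarith)
    (fun v _ => (hasGrad_kernel.hasDerivAt_fst v one_pos).continuousAt.continuousWithinAt)
    (fun v _ => hasGrad_kernel.hasDerivAt_fst v one_pos)
  have hR := radius_pos ξ one_pos
  have e2 : rodDiff M kernel u 1 = -(2 * M) * (1 / radius ξ 1) := by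
    rw [eq_div_iff (by linarith)] at e
    simp only [rodDiff, kernelX] at e ⊢
    linear_combination e
  have hd : |u - ξ| ≤ M := abs_le.2 ⟨by linarith [hξ.2], by linarith [hξ.1]⟩
  have h1 : |u| - M ≤ |ξ| := by linarith [abs_sub_abs_le_abs_sub u ξ]
  have h2 : |ξ| ≤ |u| + M := by linarith [abs_sub_abs_le_abs_sub ξ u, abs_sub_comm u ξ]
  have h3 := abs_le_radius ξ 1
  have h4 : radius ξ 1 ≤ |ξ| + 1 := by
    rw [radius, Real.sqrt_le_left (by positivity)]
    nlinarith [abs_nonneg ξ, sq_abs ξ]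
  have h5 : |u| / 2 ≤ radius ξ 1 := by linarith
  have e3 : 2 * M / |u| + rodDiff M kernel u 1 =
      2 * M * (radius ξ 1 - |u|) / (|u| * radius ξ 1) := by
    rw [e2]
    field_simp
    ring
  rw [e3, abs_div, abs_mul (2 * M), abs_of_pos (by positivity : 0 < 2 * M),
    abs_of_pos (by positivity : 0 < |u| * radius ξ 1)]
  have h6 : |radius ξ 1 - (|u|)| ≤ M + 1 := abs_le.2 ⟨by linarith, by linarith⟩
  calc _ ≤ 2 * M * (M + 1) / (|u| * (|u| / 2)) := by gcongr
    _ = 4 * M * (M + 1) / |u| ^ 2 := by field_simp; ring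
    _ = _ := by rw [sq_abs]

theorem summable_rodDiff_kernel {L : ℝ} (hM : 0 < M) (hL : 2 * M < L) :
    Summable fun n : ℤ => 2 * M / (|(n : ℝ)| * L) + rodDiff M kernel (0 + n * L) 1 := by
  have hL0 : 0 < L := by linarith
  refine Summable.of_norm_bounded_eventually
    (((Real.summable_one_div_int_pow (p := 2)).2 one_lt_two).mul_left
      (4 * M * (M + 1) / L ^ 2)) ?_
  filter_upwards [(Set.finite_singleton (0 : ℤ)).compl_mem_cofinite] with n hn
  have hn' : (1 : ℝ) ≤ |(n : ℝ)| := by exact_mod_cast Int.one_le_abs hn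
  have e : |(n : ℝ) * L| = |(n : ℝ)| * L := by rw [abs_mul, abs_of_pos hL0]
  have h := abs_rodDiff_kernel_add_le hM (u := n * L) (by rw [e]; nlinarith)
  rw [e] at h
  rw [zero_add, Real.norm_eq_abs]
  refine h.trans_eq ?_
  have : (n : ℝ) ≠ 0 := by exact_mod_cast hn
  field_simp

end Rod

/-! ### The periodic potential as a lattice sum -/

variable {M L : ℝ}

theorem exp_kernel (u : ℝ) {ρ : ℝ} (hρ : 0 < ρ) :
    Real.exp (kernel u ρ) = (u + radius u ρ) / ρ := by
  rw [kernel, Real.exp_arsinh, radius_div u hρ, add_div]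

/-- As `exp (arsinh (u / ρ)) = (u + radius u ρ) / ρ`, the claim is an algebraic identity between the
distances to the two ends of the rod. -/
theorem ernst₀_eq_exp (hM : 0 < M) (x : ℝ) {ρ : ℝ} (hρ : 0 < ρ) :
    ernst₀ M x ρ = Real.exp (rodDiff M kernel x ρ) := by
  have h1 := radius_sq (x - M) ρ
  have h2 := radius_sq (x + M) ρ
  have p1 := radius_pos (x - M) hρ
  have p2 := radius_pos (x + M) hρ
  have p3 : 0 < x + M + radius (x + M) ρ := by
    have h := Real.exp_pos (kernel (x + M) ρ)
    rw [exp_kernel _ hρ] at h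
    exact (div_pos_iff_of_pos_right hρ).1 h
  rw [rodDiff, Real.exp_sub, exp_kernel _ hρ, exp_kernel _ hρ, div_div_div_cancel_right₀ hρ.ne']
  change (radius (x - M) ρ + radius (x + M) ρ - 2 * M) /
    (radius (x - M) ρ + radius (x + M) ρ + 2 * M) = _
  rw [div_eq_div_iff (by positivity) p3.ne']
  linear_combination h2 - h1

/-- The constants that make the sum of the Schwarzschild potentials over the lattice converge. -/
noncomputable def latticeConst (M L : ℝ) (n : ℤ) : ℝ := 2 * M / (|(n : ℝ)| * L)

theorem hasProd_ernstFactor (hM : 0 < M) {x ρ : ℝ} (hρ : 0 < ρ)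
    (hs : Summable fun n : ℤ => latticeConst M L n + rodDiff M kernel (x + n * L) ρ) :
    HasProd (fun n : ℕ => ernstFactor M L x ρ (n + 1))
      (Real.exp (latticeSum L (latticeConst M L) (rodDiff M kernel) x ρ -
        rodDiff M kernel x ρ)) := by
  -- Pairing `n` with `-n` counts the term at `0` twice; dropping the pair at `0` leaves the full
  -- sum minus one copy of that term.
  have h := (hasSum_nat_add_iff' 1).2 hs.hasSum.nat_add_neg
  have h' := h.rexp
  convert h' using 1
  · funext n
    have e : ∀ m : ℤ, latticeConst M L (-m) = latticeConst M L m := fun m => by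
      simp [latticeConst]
    have e' : latticeConst M L ((n + 1 : ℕ) : ℤ) = 2 * M / ((n + 1 : ℕ) * L) := by
      simp only [latticeConst, Int.cast_natCast, Nat.abs_cast]
    simp only [Function.comp, e, e', ernstFactor, ernst₀_eq_exp hM _ hρ, ← Real.exp_add]
    congr 1
    push_cast
    rw [show x - (n + 1) * L = x + -(n + 1) * L by ring]
    ring
  -- Division by zero makes `latticeConst M L 0 = 0`, so the central rod is not renormalized.
  · simp [latticeSum, latticeConst]

theorem ernst_eq_exp (hM : 0 < M) {x ρ : ℝ} (hρ : 0 < ρ)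
    (hs : Summable fun n : ℤ => latticeConst M L n + rodDiff M kernel (x + n * L) ρ) :
    ernst M L x ρ =
      Real.exp (latticeSum L (latticeConst M L) (rodDiff M kernel) x ρ) := by
  rw [ernst, (hasProd_ernstFactor hM hρ hs).tprod_eq, ernst₀_eq_exp hM x hρ, ← Real.exp_add]
  congr 1
  ring

/-- The derivative of `omega` in `x`. -/
noncomputable def omegaX (M L : ℝ) : ℝ → ℝ → ℝ := latticeSum L 0 (rodDiff M kernelX)

/-- The derivative of `omega` in `ρ`. -/
noncomputable def omegaR (M L : ℝ) : ℝ → ℝ → ℝ := latticeSum L 0 (rodDiff M kernelR)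

/-- The second derivative of `omega` in `x`. -/
noncomputable def omegaXX (M L : ℝ) : ℝ → ℝ → ℝ := latticeSum L 0 (rodDiff M kernelXX)

/-- The mixed second derivative of `omega`. -/
noncomputable def omegaXR (M L : ℝ) : ℝ → ℝ → ℝ := latticeSum L 0 (rodDiff M kernelXR)

/-- The second derivative of `omega` in `ρ`. -/
noncomputable def omegaRR (M L : ℝ) : ℝ → ℝ → ℝ := latticeSum L 0 (rodDiff M kernelRR)

theorem lattice_kernel (hM : 0 < M) (hL : 2 * M < L) :
    (∀ x ρ : ℝ, 0 < ρ →
      Summable fun n : ℤ => latticeConst M L n + rodDiff M kernel (x + n * L) ρ) ∧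
      HasGrad (latticeSum L (latticeConst M L) (rodDiff M kernel)) (omegaX M L) (omegaR M L) :=
  (hasGrad_kernel.rodDiff M).lattice (decaysSq_rodDiff_kernelX hM) (decaysSq_rodDiff_kernelR hM)
    (by linarith) (summable_rodDiff_kernel hM hL)

theorem multipliable_ernstFactor (hM : 0 < M) (hL : 2 * M < L) (x : ℝ) {ρ : ℝ} (hρ : 0 < ρ) :
    Multipliable fun n : ℕ => ernstFactor M L x ρ (n + 1) :=
  (hasProd_ernstFactor hM hρ ((lattice_kernel hM hL).1 x ρ hρ)).multipliable

theorem ernst_pos (hM : 0 < M) (hL : 2 * M < L) (x : ℝ) {ρ : ℝ} (hρ : 0 < ρ) :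
    0 < ernst M L x ρ := by
  rw [ernst_eq_exp hM hρ ((lattice_kernel hM hL).1 x ρ hρ)]
  exact Real.exp_pos _

theorem hasGrad_omega (hM : 0 < M) (hL : 2 * M < L) :
    HasGrad (omega M L) (omegaX M L) (omegaR M L) := by
  intro x ρ hρ
  refine ((lattice_kernel hM hL).2 x ρ hρ).congr_of_eventuallyEq ?_
  filter_upwards [(isOpen_Ioi.preimage continuous_snd).mem_nhds
    (show (x, ρ) ∈ Prod.snd ⁻¹' Set.Ioi 0 from hρ)] with z hz
  rw [omega, ernst_eq_exp hM hz ((lattice_kernel hM hL).1 z.1 z.2 hz), Real.log_exp]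

theorem hasGrad_omegaX (hM : 0 < M) (hL : 0 < L) :
    HasGrad (omegaX M L) (omegaXX M L) (omegaXR M L) :=
  ((hasGrad_kernelX.rodDiff M).lattice (decaysSq_kernelXX.rodDiff hM)
    (decaysSq_kernelXR.rodDiff hM) hL
    (by simpa using (decaysSq_rodDiff_kernelX hM).summable hL 0 one_pos)).2

theorem hasGrad_omegaR (hM : 0 < M) (hL : 0 < L) :
    HasGrad (omegaR M L) (omegaXR M L) (omegaRR M L) :=
  ((hasGrad_kernelR.rodDiff M).lattice (decaysSq_kernelXR.rodDiff hM)
    (decaysSq_rodDiff_kernelRR hM) hL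
    (by simpa using (decaysSq_rodDiff_kernelR hM).summable hL 0 one_pos)).2

/-- `omega` is an axisymmetric harmonic function. -/
theorem omegaRR_eq (hM : 0 < M) (hL : 0 < L) (x : ℝ) {ρ : ℝ} (hρ : 0 < ρ) :
    omegaRR M L x ρ = -(1 / ρ) * omegaR M L x ρ - omegaXX M L x ρ := by
  simp only [omegaRR, omegaR, omegaXX, latticeSum, rodDiff_kernelRR, Pi.zero_apply, zero_add]
  rw [Summable.tsum_sub
    (((decaysSq_rodDiff_kernelR hM).summable hL x hρ).mul_left _)
    ((decaysSq_kernelXX.rodDiff hM).summable hL x hρ), tsum_mul_left]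

/-! ### Existence of the conformal factor -/

theorem exists_isConformalFactor (hM : 0 < M) (hL : 2 * M < L) :
    ∃ k : ℝ → ℝ → ℝ, IsConformalFactor (omega M L) k := by
  have hL0 : 0 < L := by linarith
  set s : Set (ℝ × ℝ) := Set.univ ×ˢ Set.Ioi 0 with hs
  have hsc : Convex ℝ s := convex_univ.prod (convex_Ioi 0)
  have hso : IsOpen s := isOpen_univ.prod isOpen_Ioi
  set A : ℝ × ℝ → ℝ := fun z => z.2 / 2 * omegaX M L z.1 z.2 * omegaR M L z.1 z.2 with hA
  set B : ℝ × ℝ → ℝ := fun z => z.2 / 4 * (omegaR M L z.1 z.2 ^ 2 - omegaX M L z.1 z.2 ^ 2)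
    with hB
  -- The common entry `b` expresses `A_ρ = B_x`, the closedness of `A dx + B dρ`. It follows from
  -- the Laplace equation, and the Poincaré lemma on the convex half-plane then gives `k`.
  have key : ∀ z ∈ s, ∃ a b c : ℝ, HasFDerivAt A (gradForm a b) z ∧
      HasFDerivAt B (gradForm b c) z := by
    rintro ⟨x, ρ⟩ ⟨-, hρ⟩
    replace hρ : 0 < ρ := hρ
    have hX := hasGrad_omegaX hM hL0 x ρ hρ
    have hR := hasGrad_omegaR hM hL0 x ρ hρ
    have hz : HasFDerivAt (fun z : ℝ × ℝ => z.2) (gradForm 0 1) (x, ρ) :=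
      hasFDerivAt_snd.congr_fderiv (by ext <;> simp)
    have hlap := omegaRR_eq hM hL0 x hρ
    refine ⟨ρ / 2 * (omegaXX M L x ρ * omegaR M L x ρ + omegaX M L x ρ * omegaXR M L x ρ),
      ρ / 2 * (omegaR M L x ρ * omegaXR M L x ρ - omegaX M L x ρ * omegaXX M L x ρ),
      (omegaR M L x ρ ^ 2 - omegaX M L x ρ ^ 2) / 4 +
        ρ / 2 * (omegaR M L x ρ * omegaRR M L x ρ - omegaX M L x ρ * omegaXR M L x ρ), ?_, ?_⟩
    · refine ((((hz.mul_const (2⁻¹ : ℝ)).mul hX).mul hR).congr_fderiv ?_).congr_of_eventuallyEq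
        (.of_forall fun z => by simp [hA, div_eq_mul_inv])
      ext
      · simp
        ring
      · simp [hlap]
        field_simp
        ring
    · refine (((hz.mul_const (4⁻¹ : ℝ)).mul
        ((hR.pow 2).sub (hX.pow 2))).congr_fderiv ?_).congr_of_eventuallyEq
        (.of_forall fun z => by simp [hB, div_eq_mul_inv])
      ext
      · simp
        ring
      · simp
        ring
  choose! a b c hab using key
  obtain ⟨f, hf⟩ := hsc.exists_forall_hasFDerivWithinAt_of_hasFDerivWithinAt_symmetric
    (ω := fun z => gradForm (A z) (B z))
    (dω := fun z => (gradForm (a z) (b z)).smulRight (ContinuousLinearMap.fst ℝ ℝ ℝ) +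
      (gradForm (b z) (c z)).smulRight (ContinuousLinearMap.snd ℝ ℝ ℝ))
    (fun z hz => (((hab z hz).1.smul_const (ContinuousLinearMap.fst ℝ ℝ ℝ)).add
      ((hab z hz).2.smul_const (ContinuousLinearMap.snd ℝ ℝ ℝ))).hasFDerivWithinAt)
    (fun z hz u _ v _ => by simp; ring)
  have hk : HasGrad (fun x ρ => f (x, ρ)) (fun x ρ => A (x, ρ)) (fun x ρ => B (x, ρ)) :=
    fun x ρ hρ => (hf (x, ρ) ⟨trivial, hρ⟩).hasFDerivAt (hso.mem_nhds ⟨trivial, hρ⟩)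
  have hω := hasGrad_omega hM hL
  exact ⟨fun x ρ => f (x, ρ), fun x ρ hρ => ⟨omegaX M L x ρ, omegaR M L x ρ,
    hω.hasDerivAt_fst x hρ, hω.hasDerivAt_snd x hρ, hk.hasDerivAt_snd x hρ,
    hk.hasDerivAt_fst x hρ⟩⟩

/-! ### Comparison of lattice sums with integrals -/

/-- The error of a one-point quadrature formula. -/
theorem abs_mul_sub_primitive_le {G φ φ' : ℝ → ℝ} {x B : ℝ} (hL : 0 < L)
    (hG : ∀ u, HasDerivAt G (φ u) u) (hφ : ∀ u, HasDerivAt φ (φ' u) u)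
    (hB : ∀ u ∈ Set.Icc x (x + L), |φ' u| ≤ B) :
    |L * φ x - (G (x + L) - G x)| ≤ B * L ^ 2 := by
  obtain ⟨ξ, hξ, e⟩ := exists_hasDerivAt_eq_slope G φ (a := x) (b := x + L) (by linarith)
    (fun v _ => (hG v).continuousAt.continuousWithinAt) (fun v _ => hG v)
  rw [add_sub_cancel_left, eq_div_iff hL.ne'] at e
  have h := (convex_Icc x (x + L)).norm_image_sub_le_of_norm_hasDerivWithin_le
    (f := φ) (f' := φ') (C := B) (fun u _ => (hφ u).hasDerivWithinAt) (fun u hu => hB u hu)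
    (Set.Ioo_subset_Icc_self hξ) (Set.left_mem_Icc.2 (by linarith))
  have hξL : ‖x - ξ‖ ≤ L := by
    rw [Real.norm_eq_abs, abs_le]
    constructor <;> linarith [hξ.1, hξ.2]
  have hB0 : 0 ≤ B := (abs_nonneg _).trans (hB x (Set.left_mem_Icc.2 (by linarith)))
  rw [← e, show L * φ x - φ ξ * L = L * (φ x - φ ξ) by ring, abs_mul, abs_of_pos hL]
  calc L * |φ x - φ ξ| ≤ L * (B * L) := by
        gcongr
        exact h.trans (by gcongr)
    _ = _ := by ring

/-- The partial sums over `-N ≤ n < N` telescope to `g N - g (-N)`. -/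
theorem tsum_int_sub_of_tendsto {g : ℤ → ℝ} {c : ℝ}
    (hs : Summable fun n : ℤ => g (n + 1) - g n)
    (hc : Tendsto (fun N : ℕ => g N - g (-N)) atTop (nhds c)) :
    ∑' n : ℤ, (g (n + 1) - g n) = c := by
  have h := hs.hasSum.nat_add_neg_add_one.tendsto_sum_nat
  refine tendsto_nhds_unique h (hc.congr fun N => ?_)
  induction N with
  | zero => simp
  | succ N ih =>
    rw [Finset.sum_range_succ, ← ih]
    push_cast
    rw [show -((N : ℤ) + 1) + 1 = -(N : ℤ) by ring]
    ring

theorem summable_one_div_sqrt_pow_three :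
    Summable fun n : ℤ => 1 / √(1 + |(n : ℝ)|) ^ 3 := by
  refine Summable.of_norm_bounded_eventually
    (Real.summable_abs_int_rpow (b := 3 / 2) (by norm_num)) ?_
  filter_upwards [(Set.finite_singleton (0 : ℤ)).compl_mem_cofinite] with n hn
  have hn' : 0 < |(n : ℝ)| := abs_pos.2 (by exact_mod_cast hn)
  rw [Real.norm_eq_abs, abs_of_pos (by positivity), Real.rpow_neg hn'.le, ← one_div]
  have e : |(n : ℝ)| ^ (3 / 2 : ℝ) = √|(n : ℝ)| ^ 3 := by
    rw [Real.sqrt_eq_rpow, ← Real.rpow_natCast, ← Real.rpow_mul hn'.le]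
    norm_num
  rw [e]
  gcongr
  linarith

/-- The distance from a point of the `n`-th cell to the origin, from below. -/
theorem one_div_radius_cube_le {x u s ρ : ℝ} {n : ℤ} (hL : 0 < L) (hM : 0 < M) (hML : 2 * M < L)
    (hρ : 1 ≤ ρ) (hx : x ∈ Set.Ico 0 L) (hs : |s| ≤ M)
    (hu : u ∈ Set.Icc (x + n * L) (x + n * L + L)) :
    1 / radius (u + s) ρ ^ 3 ≤
      √(1 / L + 4) ^ 3 * (1 / (ρ * √ρ)) * (1 / √(1 + |(n : ℝ)|) ^ 3) := by
  have hρ0 : 0 < ρ := by linarith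
  have hR := radius_pos (u + s) hρ0
  -- The offset of `u + s` from `n * L` is at most `x + L + M`, which is below `3 * L`.
  have h1 : |(n : ℝ)| * L ≤ |u + s| + 3 * L := by
    rw [← abs_of_pos hL, ← abs_mul, abs_of_pos hL]
    have h2 := abs_le.1 hs
    have h3 := le_abs_self (u + s)
    have h4 := neg_abs_le (u + s)
    rw [abs_le]
    constructor <;> linarith [hu.1, hu.2, hx.1, hx.2]
  -- The squared radius dominates both `|u + s| * ρ` and, for `ρ ≥ 1`, `ρ`. Its power `3/2` then
  -- splits into a summable factor in `n` and the factor `ρ ^ (3/2)`.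
  have h2 : (1 + |(n : ℝ)|) * ρ ≤ (1 / L + 4) * radius (u + s) ρ ^ 2 := by
    have h3 : |(n : ℝ)| ≤ 1 / L * |u + s| + 3 := by
      have : |(n : ℝ)| = 1 / L * (|(n : ℝ)| * L) := by field_simp
      rw [this]
      calc _ ≤ 1 / L * (|u + s| + 3 * L) := by gcongr
        _ = _ := by field_simp
    have h4 : |u + s| * ρ ≤ radius (u + s) ρ ^ 2 := by
      rw [sq]
      exact mul_le_mul (abs_le_radius _ _) (le_radius _ _) hρ0.le hR.le
    have h5 : ρ ≤ radius (u + s) ρ ^ 2 := by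
      rw [radius_sq]
      nlinarith [sq_nonneg (u + s)]
    have h6 : 1 / L * (|u + s| * ρ) ≤ 1 / L * radius (u + s) ρ ^ 2 := by gcongr
    have h7 := mul_le_mul_of_nonneg_right h3 hρ0.le
    linarith
  have h3 : √(1 + |(n : ℝ)|) * √ρ ≤ √(1 / L + 4) * radius (u + s) ρ := by
    rw [← Real.sqrt_mul (by positivity)]
    conv_rhs => rw [← Real.sqrt_sq hR.le, ← Real.sqrt_mul (by positivity)]
    exact Real.sqrt_le_sqrt h2
  have h4 : (√(1 + |(n : ℝ)|) * √ρ) ^ 3 ≤ (√(1 / L + 4) * radius (u + s) ρ) ^ 3 := by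
    gcongr
  have h5 : √ρ ^ 3 = ρ * √ρ := by
    rw [pow_succ, Real.sq_sqrt hρ0.le]
  rw [mul_pow, mul_pow, h5] at h4
  rw [mul_assoc, one_div_mul_one_div, mul_one_div, div_le_div_iff₀ (by positivity) (by positivity)]
  linarith

theorem latticeSum_zero_translate (F : ℝ → ℝ → ℝ) (x ρ : ℝ) (m : ℤ) :
    latticeSum L 0 F (x + m * L) ρ = latticeSum L 0 F x ρ := by
  simp only [latticeSum, Pi.zero_apply, zero_add]
  rw [← (Equiv.addLeft m).tsum_eq fun n : ℤ => F (x + n * L) ρ]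
  congr 1
  funext n
  simp only [Equiv.coe_addLeft]
  push_cast
  ring_nf

/-- Comparison of the sum over the lattice with the integral: if `F` has the primitive `G` and the
derivative `F'` in `x`, and `F'` is the difference over the rod of a function with derivative
`O(1 / radius ^ 3)`, then the sum of `F` over the lattice is the integral of `F` divided by `L`
up to `O(ρ ^ (-3/2))`. -/
theorem exists_abs_latticeSum_sub_le {G F E E' : ℝ → ℝ → ℝ} {c : ℝ → ℝ} {K : ℝ}
    (hM : 0 < M) (hL : 2 * M < L)
    (hG : ∀ u ρ, 0 < ρ → HasDerivAt (fun v => G v ρ) (F u ρ) u)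
    (hF : ∀ u ρ, 0 < ρ → HasDerivAt (fun v => F v ρ) (rodDiff M E u ρ) u)
    (hE : ∀ u ρ, 0 < ρ → HasDerivAt (fun v => E v ρ) (E' u ρ) u)
    (hE' : ∀ u ρ, 0 < ρ → |E' u ρ| ≤ K / radius u ρ ^ 3)
    (hs : ∀ x ρ, 0 < ρ → Summable fun n : ℤ => F (x + n * L) ρ)
    (hc : ∀ x ρ, 0 < ρ →
      Tendsto (fun N : ℕ => G (x + N * L) ρ - G (x - N * L) ρ) atTop (nhds (c ρ))) :
    ∃ K' : ℝ, 0 ≤ K' ∧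
      ∀ x ρ, 1 ≤ ρ → |latticeSum L 0 F x ρ - c ρ / L| ≤ K' / (ρ * √ρ) := by
  have hL0 : 0 < L := by linarith
  have hK : 0 ≤ K := by
    have h := (abs_nonneg _).trans (hE' 0 1 one_pos)
    by_contra! h0
    exact h.not_gt (div_neg_of_neg_of_pos h0 (pow_pos (radius_pos 0 one_pos) 3))
  set S : ℝ := ∑' n : ℤ, 1 / √(1 + |(n : ℝ)|) ^ 3 with hS
  have hS0 : 0 ≤ S := tsum_nonneg fun n => by positivity
  -- The factor `2 * M` comes from the mean value bound over the rod, `L ^ 2` from the quadrature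
  -- error.
  set D : ℝ := K * √(1 / L + 4) ^ 3 * (2 * M) * L ^ 2 with hD
  have hD0 : 0 ≤ D := by positivity
  have main : ∀ x ∈ Set.Ico 0 L, ∀ ρ, 1 ≤ ρ →
      |L * latticeSum L 0 F x ρ - c ρ| ≤ D * S / (ρ * √ρ) := by
    intro x hx ρ hρ
    have hρ0 : 0 < ρ := by linarith
    set b : ℤ → ℝ := fun n => D * (1 / (ρ * √ρ)) * (1 / √(1 + |(n : ℝ)|) ^ 3) with hb
    have hbs : HasSum b (D * (1 / (ρ * √ρ)) * S) :=
      summable_one_div_sqrt_pow_three.hasSum.mul_left _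
    set g : ℤ → ℝ := fun n => G (x + n * L) ρ with hg
    have herr : ∀ n : ℤ, |L * F (x + n * L) ρ - (g (n + 1) - g n)| ≤ b n := by
      intro n
      have h := abs_mul_sub_primitive_le (x := x + n * L) hL0 (fun u => hG u ρ hρ0)
        (fun u => hF u ρ hρ0)
        (B := K * (√(1 / L + 4) ^ 3 * (1 / (ρ * √ρ)) * (1 / √(1 + |(n : ℝ)|) ^ 3)) * (2 * M))
        (fun u hu => abs_rodDiff_le hM (fun v => hE v ρ hρ0) fun s hs' => by
          refine (hE' _ ρ hρ0).trans ?_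
          rw [← mul_one_div]
          gcongr
          exact one_div_radius_cube_le hL0 hM hL hρ hx hs' hu)
      have e : g (n + 1) = G (x + n * L + L) ρ := by
        simp only [hg]
        push_cast
        ring_nf
      rw [e]
      refine h.trans_eq ?_
      simp only [hb, hD]
      ring
    have hF' : HasSum (fun n : ℤ => L * F (x + n * L) ρ) (L * latticeSum L 0 F x ρ) := by
      have := (hs x ρ hρ0).hasSum.mul_left L
      simpa [latticeSum] using this
    have herrs : Summable fun n : ℤ => L * F (x + n * L) ρ - (g (n + 1) - g n) :=
      Summable.of_norm_bounded hbs.summable herr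
    have hgs : Summable fun n : ℤ => g (n + 1) - g n := by
      simpa using hF'.summable.sub herrs
    have hgt : ∑' n : ℤ, (g (n + 1) - g n) = c ρ := by
      refine tsum_int_sub_of_tendsto hgs ((hc x ρ hρ0).congr fun N => ?_)
      simp [hg, sub_eq_add_neg]
    have h := tsum_of_norm_bounded
      (f := fun n : ℤ => L * F (x + n * L) ρ - (g (n + 1) - g n)) hbs herr
    rw [hF'.summable.tsum_sub hgs, hF'.tsum_eq, hgt] at h
    refine h.trans_eq ?_
    ring
  refine ⟨D * S / L, by positivity, fun x ρ hρ => ?_⟩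
  -- Periodicity makes the estimate on one period uniform in `x`.
  obtain ⟨y, hy, e⟩ : ∃ y ∈ Set.Ico 0 L, latticeSum L 0 F x ρ = latticeSum L 0 F y ρ :=
    Function.Periodic.exists_mem_Ico₀ (f := fun y => latticeSum L 0 F y ρ)
      (fun y => by simpa using latticeSum_zero_translate F y ρ 1) hL0 x
  rw [e]
  have e2 : latticeSum L 0 F y ρ - c ρ / L = (L * latticeSum L 0 F y ρ - c ρ) / L := by
    field_simp
  rw [e2, abs_div, abs_of_pos hL0, div_right_comm]
  gcongr
  exact main y hy ρ hρ

/-! ### Asymptotics of the derivatives of `ω` -/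

theorem tendsto_lattice_atTop (hL : 0 < L) (x : ℝ) :
    Tendsto (fun N : ℕ => x + N * L) atTop atTop :=
  tendsto_atTop_add_const_left _ _ (tendsto_natCast_atTop_atTop.atTop_mul_const hL)

/-- For `u > 0` the difference is `ρ² / (radius u ρ + u)`, hence at most `ρ² / u`. -/
theorem tendsto_radius_sub (ρ : ℝ) : Tendsto (fun u => radius u ρ - u) atTop (nhds 0) := by
  have h : Tendsto (fun u : ℝ => ρ ^ 2 / u) atTop (nhds 0) :=
    tendsto_const_nhds.div_atTop tendsto_id
  refine squeeze_zero' (.of_forall fun u => ?_) ?_ h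
  · linarith [le_abs_self u, abs_le_radius u ρ]
  · filter_upwards [eventually_gt_atTop 0] with u hu
    have h1 := radius_sq u ρ
    have h2 := (le_abs_self u).trans (abs_le_radius u ρ)
    rw [le_div_iff₀ hu]
    nlinarith

theorem tendsto_rodDiff_radius (M ρ : ℝ) :
    Tendsto (fun x => rodDiff M radius x ρ) atTop (nhds (-(2 * M))) := by
  have h := ((tendsto_radius_sub ρ).comp (tendsto_atTop_add_const_right _ (-M) tendsto_id)).sub
    ((tendsto_radius_sub ρ).comp (tendsto_atTop_add_const_right _ M tendsto_id))
  have h' := h.add_const (-(2 * M))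
  simp only [sub_zero, zero_add] at h'
  refine h'.congr fun x => ?_
  simp [rodDiff, sub_eq_add_neg]
  ring

theorem rodDiff_radius_neg (x ρ : ℝ) : rodDiff M radius (-x) ρ = -rodDiff M radius x ρ := by
  rw [rodDiff, rodDiff, ← radius_neg (-x - M), ← radius_neg (-x + M)]
  ring_nf

theorem rodDiff_kernel_neg (x ρ : ℝ) : rodDiff M kernel (-x) ρ = rodDiff M kernel x ρ := by
  have h : ∀ u, kernel (-u) ρ = -kernel u ρ := fun u => by
    rw [kernel, neg_div, Real.arsinh_neg, kernel]
  rw [rodDiff, rodDiff, show -x - M = -(x + M) by ring, show -x + M = -(x - M) by ring, h, h]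
  ring

theorem tendsto_rodDiff_kernel (hM : 0 < M) {ρ : ℝ} (hρ : 0 < ρ) :
    Tendsto (fun x => rodDiff M kernel x ρ) atTop (nhds 0) := by
  have h : Tendsto (fun x : ℝ => 1 / (x - M) * (2 * M)) atTop (nhds 0) := by
    have : Tendsto (fun x : ℝ => 1 / (x + -M)) atTop (nhds 0) :=
      tendsto_const_nhds.div_atTop (tendsto_atTop_add_const_right _ (-M) tendsto_id)
    simpa [sub_eq_add_neg] using this.mul_const (2 * M)
  refine squeeze_zero_norm' ?_ h
  filter_upwards [eventually_gt_atTop M] with x hx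
  refine abs_rodDiff_le hM (fun u => hasGrad_kernel.hasDerivAt_fst u hρ) fun s hs => ?_
  have h1 : x - M ≤ radius (x + s) ρ := by
    linarith [le_abs_self (x + s), abs_le_radius (x + s) ρ, neg_abs_le s]
  rw [kernelX, abs_of_pos (one_div_pos.2 (radius_pos _ hρ))]
  exact one_div_le_one_div_of_le (by linarith) h1

/-- The primitive `rodDiff M kernel` vanishes at both ends of the line, so the integral is `0`. -/
theorem exists_abs_omegaX_le (hM : 0 < M) (hL : 2 * M < L) :
    ∃ K : ℝ, 0 ≤ K ∧ ∀ x ρ, 1 ≤ ρ → |omegaX M L x ρ| ≤ K / (ρ * √ρ) := by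
  have hL0 : 0 < L := by linarith
  have h := exists_abs_latticeSum_sub_le (G := rodDiff M kernel) (F := rodDiff M kernelX)
    (E := kernelXX) (c := fun _ => 0) hM hL
    (fun u ρ hρ => (hasGrad_kernel.rodDiff M).hasDerivAt_fst u hρ)
    (fun u ρ hρ => (hasGrad_kernelX.rodDiff M).hasDerivAt_fst u hρ)
    (fun u ρ hρ => hasDerivAt_kernelXX u hρ) (fun u ρ hρ => abs_deriv_kernelXX_le u hρ)
    (fun x ρ hρ => (decaysSq_rodDiff_kernelX hM).summable hL0 x hρ) (fun x ρ hρ => ?_)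
  · simpa [omegaX] using h
  · have h1 := (tendsto_rodDiff_kernel hM hρ).comp (tendsto_lattice_atTop hL0 x)
    have h2 := (tendsto_rodDiff_kernel hM hρ).comp (tendsto_lattice_atTop hL0 (-x))
    have h3 := h1.sub h2
    rw [sub_zero] at h3
    refine h3.congr fun N => ?_
    simp only [Function.comp]
    rw [← rodDiff_kernel_neg (-x + N * L), neg_add, neg_neg, sub_eq_add_neg x]

/-- The primitive `-(1 / ρ) * rodDiff M radius` tends to `±2M / ρ` at the ends; its total increment
`4M / ρ` is the source of the Kasner index `4M / L`. -/
theorem exists_abs_omegaR_sub_le (hM : 0 < M) (hL : 2 * M < L) :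
    ∃ K : ℝ, 0 ≤ K ∧
      ∀ x ρ, 1 ≤ ρ → |omegaR M L x ρ - 4 * M / L / ρ| ≤ K / (ρ * √ρ) := by
  have hL0 : 0 < L := by linarith
  have h := exists_abs_latticeSum_sub_le
    (G := fun x ρ => rodDiff M radius x ρ * (-(1 / ρ))) (F := rodDiff M kernelR)
    (E := kernelXR) (c := fun ρ => 4 * M / ρ) hM hL
    (fun u ρ hρ => ?_)
    (fun u ρ hρ => (hasGrad_kernelR.rodDiff M).hasDerivAt_fst u hρ)
    (fun u ρ hρ => hasDerivAt_kernelXR u hρ) (fun u ρ hρ => abs_deriv_kernelXR_le u hρ)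
    (fun x ρ hρ => (decaysSq_rodDiff_kernelR hM).summable hL0 x hρ) (fun x ρ hρ => ?_)
  · simpa only [omegaR, div_right_comm] using h
  · have hr : HasGrad radius (fun u ρ => u / radius u ρ) (fun u ρ => ρ / radius u ρ) :=
      fun u ρ hρ => hasFDerivAt_radius u hρ
    refine (((hr.rodDiff M).hasDerivAt_fst u hρ).mul_const (-(1 / ρ))).congr_deriv ?_
    have h1 := (radius_pos (u - M) hρ).ne'
    have h2 := (radius_pos (u + M) hρ).ne'
    simp only [rodDiff, kernelR]
    field_simp
    ring
  · have h1 := (tendsto_rodDiff_radius M ρ).comp (tendsto_lattice_atTop hL0 x)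
    have h2 := (tendsto_rodDiff_radius M ρ).comp (tendsto_lattice_atTop hL0 (-x))
    have h3 := (h1.add h2).mul_const (-(1 / ρ))
    rw [show (-(2 * M) + -(2 * M)) * -(1 / ρ) = 4 * M / ρ by ring] at h3
    refine h3.congr fun N => ?_
    simp only [Function.comp]
    rw [show x - N * L = -(-x + N * L) by ring, rodDiff_radius_neg]
    ring

/-! ### Integrating the derivative estimates up to infinity -/

theorem tendsto_div_sqrt (K : ℝ) : Tendsto (fun ρ : ℝ => K / √ρ) atTop (nhds 0) :=
  tendsto_const_nhds.div_atTop Real.tendsto_sqrt_atTop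

theorem hasDerivAt_div_sqrt (K : ℝ) {ρ : ℝ} (hρ : 0 < ρ) :
    HasDerivAt (fun r => 2 * K / √r) (-(K / (ρ * √ρ))) ρ := by
  have hs := (Real.sqrt_pos.2 hρ).ne'
  have h := ((Real.hasDerivAt_sqrt hρ.ne').inv hs).const_mul (2 * K)
  refine (h.congr_deriv ?_).congr_of_eventuallyEq (.of_forall fun r => by
    simp [div_eq_mul_inv])
  rw [Real.sq_sqrt hρ.le]
  field_simp

/-- A function on `[1, ∞)` whose derivative is `O(ρ ^ (-3/2))` converges at infinity. -/
theorem exists_limit_of_abs_deriv_le {f f' : ℝ → ℝ} {K : ℝ}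
    (hf : ∀ ρ, 1 ≤ ρ → HasDerivAt f (f' ρ) ρ) (hf' : ∀ ρ, 1 ≤ ρ → |f' ρ| ≤ K / (ρ * √ρ)) :
    ∃ c : ℝ, ∀ ρ, 1 ≤ ρ → |f ρ - c| ≤ 2 * K / √ρ := by
  have hK : 0 ≤ K := by simpa using (abs_nonneg _).trans (hf' 1 le_rfl)
  have hint : ∀ ρ ∈ interior (Set.Ici (1 : ℝ)), 1 ≤ ρ := fun ρ hρ => interior_subset hρ
  -- Correcting `f` by the primitive `2 * K / √ρ` of the bound gives an increasing lower and a
  -- decreasing upper envelope; the limit is the supremum of the lower one.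
  have hlow : MonotoneOn (fun ρ => f ρ - 2 * K / √ρ) (Set.Ici 1) := by
    have hd : ∀ ρ, 1 ≤ ρ →
        HasDerivAt (fun ρ => f ρ - 2 * K / √ρ) (f' ρ - -(K / (ρ * √ρ))) ρ := fun ρ hρ =>
      (hf ρ hρ).sub (hasDerivAt_div_sqrt K (by linarith))
    refine monotoneOn_of_deriv_nonneg (convex_Ici 1)
      (fun ρ hρ => (hd ρ hρ).continuousAt.continuousWithinAt)
      (fun ρ hρ => (hd ρ (hint ρ hρ)).differentiableAt.differentiableWithinAt) fun ρ hρ => ?_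
    rw [(hd ρ (hint ρ hρ)).deriv]
    linarith [(abs_le.1 (hf' ρ (hint ρ hρ))).1]
  have hup : AntitoneOn (fun ρ => f ρ + 2 * K / √ρ) (Set.Ici 1) := by
    have hd : ∀ ρ, 1 ≤ ρ →
        HasDerivAt (fun ρ => f ρ + 2 * K / √ρ) (f' ρ + -(K / (ρ * √ρ))) ρ := fun ρ hρ =>
      (hf ρ hρ).add (hasDerivAt_div_sqrt K (by linarith))
    refine antitoneOn_of_deriv_nonpos (convex_Ici 1)
      (fun ρ hρ => (hd ρ hρ).continuousAt.continuousWithinAt)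
      (fun ρ hρ => (hd ρ (hint ρ hρ)).differentiableAt.differentiableWithinAt) fun ρ hρ => ?_
    rw [(hd ρ (hint ρ hρ)).deriv]
    linarith [(abs_le.1 (hf' ρ (hint ρ hρ))).2]
  have hle : ∀ ρ, 1 ≤ ρ → ∀ r, 1 ≤ r → f r - 2 * K / √r ≤ f ρ + 2 * K / √ρ := by
    intro ρ hρ r hr
    have h1 := hlow hr (Set.mem_Ici.2 (hr.trans (le_max_left r ρ))) (le_max_left r ρ)
    have h2 := hup hρ (Set.mem_Ici.2 (hr.trans (le_max_left r ρ))) (le_max_right r ρ)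
    have h3 : 0 ≤ 2 * K / √(max r ρ) := by positivity
    simp only [] at h1 h2
    linarith
  set s : Set ℝ := (fun r => f r - 2 * K / √r) '' Set.Ici 1
  have hne : s.Nonempty := ⟨_, 1, Set.self_mem_Ici, rfl⟩
  have hub : ∀ ρ, 1 ≤ ρ → f ρ + 2 * K / √ρ ∈ upperBounds s := by
    rintro ρ hρ _ ⟨r, hr, rfl⟩
    exact hle ρ hρ r hr
  refine ⟨sSup s, fun ρ hρ => abs_le.2 ⟨?_, ?_⟩⟩
  · linarith [csSup_le hne (hub ρ hρ)]
  · linarith [le_csSup ⟨_, hub 1 le_rfl⟩ (Set.mem_image_of_mem _ (Set.mem_Ici.2 hρ) :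
      f ρ - 2 * K / √ρ ∈ s)]

/-- A function with `F_ρ = a / ρ + O(ρ ^ (-3/2))` and `F_x = O(ρ ^ (-1/2))` is
`a log ρ + c + o(1)`, uniformly in `x`. -/
theorem exists_tendstoUniformly_sub_log {F F₁ F₂ : ℝ → ℝ → ℝ} {a K : ℝ}
    (h₁ : ∀ x ρ, 1 ≤ ρ → HasDerivAt (fun y => F y ρ) (F₁ x ρ) x)
    (h₂ : ∀ x ρ, 1 ≤ ρ → HasDerivAt (fun r => F x r) (F₂ x ρ) ρ)
    (b₁ : ∀ x ρ, 1 ≤ ρ → |F₁ x ρ| ≤ K / √ρ)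
    (b₂ : ∀ x ρ, 1 ≤ ρ → |F₂ x ρ - a / ρ| ≤ K / (ρ * √ρ)) :
    ∃ c : ℝ, TendstoUniformly (fun ρ x => F x ρ - a * Real.log ρ) (fun _ => c) atTop := by
  have hlim : ∀ x, ∃ c : ℝ, ∀ ρ, 1 ≤ ρ → |F x ρ - a * Real.log ρ - c| ≤ 2 * K / √ρ :=
    fun x => exists_limit_of_abs_deriv_le (f' := fun ρ => F₂ x ρ - a / ρ)
      (fun ρ hρ => ((h₂ x ρ hρ).sub ((Real.hasDerivAt_log (by linarith)).const_mul a)).congr_deriv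
        (by rw [div_eq_mul_inv])) (b₂ x)
  choose c hc using hlim
  -- The `x`-derivative tends to `0`, so the values at `x` and at `0` merge as `ρ → ∞`.
  have hconst : ∀ x, c x = c 0 := by
    intro x
    have h : ∀ ρ, 1 ≤ ρ → |c x - c 0| ≤ (4 * K + K * |x|) / √ρ := by
      intro ρ hρ
      have h3 := convex_univ.norm_image_sub_le_of_norm_hasDerivWithin_le
        (fun y _ => (h₁ y ρ hρ).hasDerivWithinAt) (fun y _ => b₁ y ρ hρ)
        (Set.mem_univ 0) (Set.mem_univ x)
      rw [sub_zero, Real.norm_eq_abs, Real.norm_eq_abs] at h3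
      have h4 := abs_le.1 (hc x ρ hρ)
      have h5 := abs_le.1 (hc 0 ρ hρ)
      have h6 := abs_le.1 h3
      have e : (4 * K + K * |x|) / √ρ = 2 * K / √ρ + 2 * K / √ρ + K / √ρ * |x| := by ring
      rw [e, abs_le]
      constructor <;> linarith
    have h0 : |c x - c 0| ≤ 0 := ge_of_tendsto (tendsto_div_sqrt _)
      ((eventually_ge_atTop 1).mono h)
    linarith [abs_nonpos_iff.1 h0]
  refine ⟨c 0, Metric.tendstoUniformly_iff.2 fun ε hε => ?_⟩
  filter_upwards [eventually_ge_atTop 1, (tendsto_div_sqrt (2 * K)).eventually_lt_const hε]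
    with ρ hρ hρε x
  rw [dist_comm, Real.dist_eq, ← hconst x]
  exact (hc x ρ hρ).trans_lt hρε

/-- Exponentiation of an asymptotic expansion with a logarithmic leading term. -/
theorem isAsymptotic_exp {f : ℝ → ℝ → ℝ} {g : ℝ → ℝ} {a c : ℝ}
    (h : TendstoUniformly (fun ρ x => f x ρ - a * Real.log ρ) (fun _ => c) atTop)
    (hg : ∀ ρ, 0 < ρ → g ρ = Real.exp c * ρ ^ a) :
    IsAsymptotic (fun x ρ => Real.exp (f x ρ)) g := by
  refine ⟨fun x ρ => Real.exp (f x ρ - a * Real.log ρ - c) - 1, ?_, fun x ρ hρ => ?_⟩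
  · rw [Metric.tendstoUniformly_iff] at h ⊢
    intro ε hε
    have hcont : ContinuousAt (fun t : ℝ => Real.exp t - 1) 0 := by fun_prop
    obtain ⟨δ, hδ, H⟩ := Metric.continuousAt_iff.1 hcont ε hε
    filter_upwards [h δ hδ] with ρ hρ x
    have h1 := @H (f x ρ - a * Real.log ρ - c)
      (by rw [Real.dist_eq, sub_zero, ← Real.dist_eq, dist_comm]; exact hρ x)
    rw [dist_comm]
    simpa using h1
  · change Real.exp (f x ρ) = _
    rw [hg ρ hρ, Real.rpow_def_of_pos hρ, add_sub_cancel, ← Real.exp_add, ← Real.exp_add]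
    congr 1
    ring

theorem IsAsymptotic.congr {f f' : ℝ → ℝ → ℝ} {g : ℝ → ℝ} (h : IsAsymptotic f g)
    (hf : ∀ x ρ, 0 < ρ → f' x ρ = f x ρ) : IsAsymptotic f' g := by
  obtain ⟨δ, hδ, e⟩ := h
  exact ⟨δ, hδ, fun x ρ hρ => (hf x ρ hρ).trans (e x ρ hρ)⟩

theorem IsAsymptotic.neg {f : ℝ → ℝ → ℝ} {g : ℝ → ℝ} (h : IsAsymptotic f g) :
    IsAsymptotic (fun x ρ => -f x ρ) (fun ρ => -g ρ) := by
  obtain ⟨δ, hδ, e⟩ := h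
  exact ⟨δ, hδ, fun x ρ hρ => by simp only [e x ρ hρ, neg_mul]⟩

theorem isAsymptotic_zero : IsAsymptotic (fun _ _ => 0) (fun _ => 0) :=
  ⟨fun _ _ => 0, tendsto_const_nhds.tendstoUniformly_const, fun _ _ _ => by simp⟩

theorem div_mul_sqrt_le {K ρ : ℝ} (hK : 0 ≤ K) (hρ : 1 ≤ ρ) : K / (ρ * √ρ) ≤ K / √ρ := by
  have : 0 < √ρ := Real.sqrt_pos.2 (by linarith)
  gcongr
  nlinarith

/-! ### Logarithmic asymptotics of `ω` and `k` -/

theorem exists_tendstoUniformly_omega (hM : 0 < M) (hL : 2 * M < L) :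
    ∃ c : ℝ, TendstoUniformly (fun ρ x => omega M L x ρ - 4 * M / L * Real.log ρ)
      (fun _ => c) atTop := by
  obtain ⟨K₁, hK₁, h₁⟩ := exists_abs_omegaX_le hM hL
  obtain ⟨K₂, hK₂, h₂⟩ := exists_abs_omegaR_sub_le hM hL
  have hω := hasGrad_omega hM hL
  refine exists_tendstoUniformly_sub_log (K := K₁ + K₂)
    (fun x ρ hρ => hω.hasDerivAt_fst x (by linarith))
    (fun x ρ hρ => hω.hasDerivAt_snd x (by linarith))
    (fun x ρ hρ => ((h₁ x ρ hρ).trans (div_mul_sqrt_le hK₁ hρ)).trans ?_)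
    (fun x ρ hρ => (h₂ x ρ hρ).trans ?_)
  · gcongr
    linarith
  · have : 0 < ρ := by linarith
    gcongr
    linarith

theorem exists_tendstoUniformly_conformalFactor (hM : 0 < M) (hL : 2 * M < L) {k : ℝ → ℝ → ℝ}
    (hk : IsConformalFactor (omega M L) k) :
    ∃ c : ℝ, TendstoUniformly (fun ρ x => k x ρ - (4 * M / L) ^ 2 / 4 * Real.log ρ)
      (fun _ => c) atTop := by
  obtain ⟨K₁, hK₁, h₁⟩ := exists_abs_omegaX_le hM hL
  obtain ⟨K₂, hK₂, h₂⟩ := exists_abs_omegaR_sub_le hM hL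
  have hω := hasGrad_omega hM hL
  have hk' : ∀ x ρ, 0 < ρ →
      HasDerivAt (fun r => k x r) (ρ / 4 * (omegaR M L x ρ ^ 2 - omegaX M L x ρ ^ 2)) ρ ∧
      HasDerivAt (fun y => k y ρ) (ρ / 2 * omegaX M L x ρ * omegaR M L x ρ) x := by
    intro x ρ hρ
    obtain ⟨ωx, ωρ, d₁, d₂, d₃, d₄⟩ := hk x ρ hρ
    rw [d₁.unique (hω.hasDerivAt_fst x hρ), d₂.unique (hω.hasDerivAt_snd x hρ)] at d₃
    rw [d₁.unique (hω.hasDerivAt_fst x hρ), d₂.unique (hω.hasDerivAt_snd x hρ)] at d₄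
    exact ⟨d₃, d₄⟩
  have hL0 : 0 < L := by linarith
  set α := 4 * M / L with hα
  have hα0 : 0 < α := by positivity
  -- The bounded `p` and `q` are the errors in units of `ρ ^ (-3/2)`; this turns the estimates for
  -- `k` into algebra.
  have hbd : ∀ x ρ, 1 ≤ ρ → ∃ p q : ℝ, omegaX M L x ρ = p / (ρ * √ρ) ∧
      omegaR M L x ρ = α / ρ + q / (ρ * √ρ) ∧ |p| ≤ K₁ ∧ |q| ≤ K₂ := by
    intro x ρ hρ
    have hpos : 0 < ρ * √ρ := by positivity
    refine ⟨omegaX M L x ρ * (ρ * √ρ), (omegaR M L x ρ - α / ρ) * (ρ * √ρ), ?_, ?_, ?_, ?_⟩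
    · rw [mul_div_cancel_right₀ _ hpos.ne']
    · rw [mul_div_cancel_right₀ _ hpos.ne', add_sub_cancel]
    · rw [abs_mul, abs_of_pos hpos, ← le_div_iff₀ hpos]
      exact h₁ x ρ hρ
    · rw [abs_mul, abs_of_pos hpos, ← le_div_iff₀ hpos]
      exact h₂ x ρ hρ
  refine exists_tendstoUniformly_sub_log
    (K := K₁ * (α + K₂) + (α * K₂ + K₁ ^ 2 + K₂ ^ 2))
    (fun x ρ hρ => (hk' x ρ (by linarith)).2) (fun x ρ hρ => (hk' x ρ (by linarith)).1)
    (fun x ρ hρ => ?_) (fun x ρ hρ => ?_)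
  · obtain ⟨p, q, e₁, e₂, hp, hq⟩ := hbd x ρ hρ
    have hρ0 : 0 < ρ := by linarith
    have hs1 : 1 ≤ √ρ := Real.one_le_sqrt.2 hρ
    have e : ρ / 2 * omegaX M L x ρ * omegaR M L x ρ =
        p * (α + q / √ρ) / (2 * ρ) / √ρ := by
      rw [e₁, e₂]
      field_simp
    have h3 : |α + q / √ρ| ≤ α + K₂ := by
      refine (abs_add_le _ _).trans (add_le_add (abs_of_pos hα0).le ?_)
      rw [abs_div, abs_of_pos (by positivity : 0 < √ρ)]
      exact (div_le_self (abs_nonneg _) hs1).trans hq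
    rw [e, abs_div, abs_of_pos (by positivity : 0 < √ρ), abs_div, abs_mul,
      abs_of_pos (by positivity : 0 < 2 * ρ)]
    gcongr
    calc |p| * |α + q / √ρ| / (2 * ρ) ≤ |p| * |α + q / √ρ| :=
          div_le_self (by positivity) (by linarith)
      _ ≤ K₁ * (α + K₂) := by gcongr
      _ ≤ _ := le_add_of_nonneg_right (by positivity)
  · obtain ⟨p, q, e₁, e₂, hp, hq⟩ := hbd x ρ hρ
    have hρ0 : 0 < ρ := by linarith
    have hs1 : 1 ≤ √ρ := Real.one_le_sqrt.2 hρ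
    have e : ρ / 4 * (omegaR M L x ρ ^ 2 - omegaX M L x ρ ^ 2) - α ^ 2 / 4 / ρ =
        (α * q / 2 + (q ^ 2 - p ^ 2) / 4 / √ρ) / (ρ * √ρ) := by
      rw [e₁, e₂]
      field_simp
      ring
    have h3 : |(q ^ 2 - p ^ 2) / 4 / √ρ| ≤ K₁ ^ 2 + K₂ ^ 2 := by
      rw [abs_div, abs_of_pos (by positivity : 0 < √ρ)]
      refine (div_le_self (abs_nonneg _) hs1).trans ?_
      have h4 : p ^ 2 ≤ K₁ ^ 2 := by rw [← sq_abs p]; gcongr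
      have h5 : q ^ 2 ≤ K₂ ^ 2 := by rw [← sq_abs q]; gcongr
      rw [abs_le]
      constructor <;> nlinarith [sq_nonneg p, sq_nonneg q]
    have h4 : |α * q / 2| ≤ α * K₂ := by
      rw [abs_div, abs_mul, abs_of_pos hα0, abs_of_pos (by norm_num : (0 : ℝ) < 2)]
      exact (div_le_self (by positivity) (by norm_num)).trans (by gcongr)
    rw [e, abs_div, abs_of_pos (by positivity : 0 < ρ * √ρ)]
    gcongr
    have h5 : 0 ≤ K₁ * (α + K₂) := by positivity
    linarith [abs_add_le (α * q / 2) ((q ^ 2 - p ^ 2) / 4 / √ρ)]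

/-- Serves to combine exponents of metric components, such as `-ω + 2k`. -/
theorem tendstoUniformly_add_log {f g : ℝ → ℝ → ℝ} {a b s t c d : ℝ}
    (hf : TendstoUniformly (fun ρ x => f x ρ - a * Real.log ρ) (fun _ => c) atTop)
    (hg : TendstoUniformly (fun ρ x => g x ρ - b * Real.log ρ) (fun _ => d) atTop) :
    TendstoUniformly (fun ρ x => s * f x ρ + t * g x ρ - (s * a + t * b) * Real.log ρ)
      (fun _ => s * c + t * d) atTop := by
  have hu : UniformContinuous fun p : ℝ × ℝ => s * p.1 + t * p.2 :=
    ((Real.uniformContinuous_const_mul).comp uniformContinuous_fst).add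
      ((Real.uniformContinuous_const_mul).comp uniformContinuous_snd)
  have h : TendstoUniformly (fun ρ x => (f x ρ - a * Real.log ρ, g x ρ - b * Real.log ρ))
      (fun _ => (c, d)) atTop := fun u hv =>
    (tendsto_id.prodMk tendsto_id : Tendsto (fun ρ : ℝ => (ρ, ρ)) atTop _).eventually
      ((hf.prodMk hg) u hv)
  have h' := hu.comp_tendstoUniformly h
  simp only [Function.comp_def] at h'
  convert h' using 3 with ρ x
  ring

end PeriodicSchwarzschild

theorem theorem4 (M L : ℝ) (hM : 0 < M) (hL : 2 * M < L) :
    (∀ x ρ : ℝ, 0 < ρ →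
      Multipliable (fun n : ℕ => ernstFactor M L x ρ (n + 1)) ∧ 0 < ernst M L x ρ) ∧
    ∃ C : ℝ, 0 < C ∧
      IsAsymptotic (ernst M L) (fun ρ => C * ρ ^ (4 * M / L)) ∧
      TendstoUniformly (fun ρ x => omega M L x ρ - 2 * M / L * Real.log (ρ ^ 2))
        (fun _ => Real.log C) Filter.atTop ∧
      (∃ k : ℝ → ℝ → ℝ, IsConformalFactor (omega M L) k) ∧
      ∀ k : ℝ → ℝ → ℝ, IsConformalFactor (omega M L) k →
        ∃ C' : ℝ, 0 < C' ∧ ∀ i j : Fin 4,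
          IsAsymptotic (fun x ρ => weylMetric (omega M L) k x ρ i j)
            (fun ρ => kasnerMetric (4 * M / L) C C' ρ i j) := by
  obtain ⟨c, hc⟩ := exists_tendstoUniformly_omega hM hL
  have hexp : ∀ x ρ, 0 < ρ → ernst M L x ρ = Real.exp (omega M L x ρ) := fun x ρ hρ =>
    (Real.exp_log (ernst_pos hM hL x hρ)).symm
  have htt := isAsymptotic_exp hc (g := fun ρ => Real.exp c * ρ ^ (4 * M / L)) fun _ _ => rfl
  refine ⟨fun x ρ hρ => ⟨multipliable_ernstFactor hM hL x hρ, ernst_pos hM hL x hρ⟩,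
    Real.exp c, Real.exp_pos c, htt.congr hexp, ?_, exists_isConformalFactor hM hL,
    fun k hk => ?_⟩
  · rw [Real.log_exp]
    convert hc using 3 with ρ x
    rw [Real.log_pow]
    push_cast
    ring
  · obtain ⟨d, hd⟩ := exists_tendstoUniformly_conformalFactor hM hL hk
    have hxx : IsAsymptotic (fun x ρ => Real.exp (-omega M L x ρ) * Real.exp (2 * k x ρ))
        (fun ρ => Real.exp (-c + 2 * d) * ρ ^ ((4 * M / L) ^ 2 / 2 - 4 * M / L)) := by
      refine (isAsymptotic_exp (tendstoUniformly_add_log (s := -1) (t := 2) hc hd)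
        (fun ρ _ => ?_)).congr fun x ρ _ => ?_
      · ring_nf
      · rw [← Real.exp_add]
        ring_nf
    have hφφ : IsAsymptotic (fun x ρ => Real.exp (-omega M L x ρ) * ρ ^ 2)
        (fun ρ => (Real.exp c)⁻¹ * ρ ^ (2 - 4 * M / L)) := by
      -- Writing `ρ ^ 2` as `exp (2 * log ρ)` puts this component in the same form, with `log ρ` in
      -- the place of `k`.
      have hlog : TendstoUniformly (fun (ρ : ℝ) (_ : ℝ) => Real.log ρ - 1 * Real.log ρ)
          (fun _ => 0) atTop := by
        simp only [one_mul, sub_self]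
        exact tendsto_const_nhds.tendstoUniformly_const
      refine (isAsymptotic_exp (tendstoUniformly_add_log (s := -1) (t := 2) hc hlog)
        (fun ρ _ => ?_)).congr fun x ρ hρ => ?_
      · rw [← Real.exp_neg]
        ring_nf
      · rw [Real.exp_add, two_mul, Real.exp_add, Real.exp_log hρ]
        ring_nf
    refine ⟨Real.exp (-c + 2 * d), Real.exp_pos _, fun i j => ?_⟩
    by_cases hij : i = j
    · subst hij
      simp only [weylMetric, kasnerMetric, Matrix.diagonal_apply_eq]
      fin_cases i
      · exact hxx
      · exact hxx
      · exact hφφ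
      · exact htt.neg
    · simp only [weylMetric, kasnerMetric, Matrix.diagonal_apply_ne _ hij]
      exact isAsymptotic_zero
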